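/- Let $\mathcal A$ be the collection of all geometric squares $\{a,ar,as,ars\}$ with $a,r,s$ positive integers and $1<r<s$. For a finite set $X$ of positive integers let $G_{\mathcal A}(X)$ be the largest size of a subset of $X$ that contains no member of $\mathcal A$. Let $p_1<p_2<\cdots$ be the primes, let $P_d=p_1p_2\cdots p_d$, let $a_d=\{\prod_{i=1}^d p_i^{e_i}: e_i\in\{0,1\}\}$, and let $\varphi$ be Euler's function. Let $c_{d,2,2}$ be the largest size of a family of subsets of $[d]=\{1,\dots,d\}$ that contains no subfamily which is a sublattice of the power set of $[d]$ (under $\cup$ and $\cap$) isomorphic to the power set of a two-element set; that is, the family does not contain four distinct sets of the form $A,\ B,\ A\cap B,\ A\cup B$. Then $G_{\mathcal A}(a_d)=c_{d,2,2}$ for every $d\ge 0$, and $$c_{0,2,2}=1,\quad c_{1,2,2}=2,\quad c_{2,2,2}=3,\quad c_{3,2,2}=6,\quad c_{4,2,2}=11,\quad c_{5,2,2}=21.$$ Moreover, the series below converges, and $$\frac56\le\limsup_{n\to\infty}\frac{G_{\mathcal A}([n])}{n}\le 1-\frac43\sum_{d=1}^{\infty}\bigl(2c_{d-1,2,2}-c_{d,2,2}\bigr)\frac{\varphi(P_d)}{P_d^2}<\frac{3699337}{4002075}.$$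 -/

import Mathlib

open Filter

/-- `A` has no subset belonging to the collection `𝒜` of proscribed sets. -/
def Avoids (𝒜 : Set (Set ℕ)) (A : Finset ℕ) : Prop :=
  ∀ B ∈ 𝒜, ¬ B ⊆ (A : Set ℕ)

open Classical in
/-- `G_𝒜(X)`: the maximum cardinality of a subset of the finite set `X` that has no subset
belonging to `𝒜`. -/
noncomputable def maxAvoid (𝒜 : Set (Set ℕ)) (X : Finset ℕ) : ℕ :=
  (X.powerset.filter (Avoids 𝒜)).sup Finset.card

/-- The geometric squares `{a, ar, as, ars}` with `a, r, s` positive integers and `1 < r < s`. -/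
def geometricSquares : Set (Set ℕ) :=
  {B | ∃ a r s : ℕ, 1 ≤ a ∧ 1 < r ∧ r < s ∧ B = {a, a * r, a * s, a * r * s}}

/-- `P_d`, the product of the first `d` primes (`Nat.nth Nat.Prime` is indexed from `0`). -/
noncomputable def primorialFirst (d : ℕ) : ℕ :=
  ∏ i : Fin d, Nat.nth Nat.Prime i

/-- `a_d = {∏_{i ≤ d} p_i ^ e_i : 0 ≤ e_i ≤ 1}`, where `p_1 < p_2 < ⋯` are the primes. -/
noncomputable def primeCube (d : ℕ) : Finset ℕ :=
  Finset.univ.image fun e : Fin d → Fin 2 => ∏ i : Fin d, Nat.nth Nat.Prime i ^ (e i : ℕ)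

/-- The family `F` of subsets of `[d]` contains a subfamily that, as a sublattice of the power set
of `[d]` (with operations union and intersection), is isomorphic to the power set of `[s]`. -/
def ContainsBooleanLattice {d : ℕ} (s : ℕ) (F : Finset (Finset (Fin d))) : Prop :=
  ∃ f : LatticeHom (Finset (Fin s)) (Finset (Fin d)), Function.Injective f ∧ ∀ T, f T ∈ F

open Classical in
/-- The generalized Sperner number `c_{d,s,2}`: the maximum cardinality of a family of subsets of
`[d]` that contains no subfamily lattice isomorphic to the power set of `[s]`. -/
noncomputable def genSperner (d s : ℕ) : ℕ :=
  (Finset.univ.filter fun F : Finset (Finset (Fin d)) => ¬ ContainsBooleanLattice s F).sup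
    Finset.card

/-! Write c_d for c_{d,2,2}. Under S ↦ ∏_{i∈S} p_i, divisibility becomes inclusion, and the four
members of a geometric square inside a dilate x·a_d become A∩B, A, B, A∪B with A, B incomparable.
Hence a set without geometric squares meets each dilate in at most c_d points
(`not_hasDiamond_dilate`), and conversely (`avoids_image_primeProd`).

For the upper density, [n] is covered by one-point cubes which are merged step by step. If x and
x·p_{d+1} are both bases of d-cubes, these two cubes together form the (d+1)-cube at x, and the
bound on their joint content drops from 2c_d to c_{d+1}. The bases used at level d ≥ 1 are the
numbers 4^j·b with b coprime to P_d. Their density, subject to x·P_d ≤ n, is φ(P_d)/P_d² times the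
sum of 4^{-j}, which is the source of 4/3. Adding the savings over d gives the series
(`card_add_sum_deficiency_le`); j and d are truncated until n → ∞.

The values of c_d come from Sperner's theorem applied to the two sections of a family along a
coordinate, and from unions of layers. The lower density bound comes from the interval (n/6, n]. -/

/-! ### Diamonds and Boolean sublattices -/

/-- The family `F` contains two incomparable sets together with their union and intersection. -/
def HasDiamond {α : Type*} [DecidableEq α] (F : Finset (Finset α)) : Prop :=
  ∃ A B : Finset α, ¬ A ⊆ B ∧ ¬ B ⊆ A ∧ A ∈ F ∧ B ∈ F ∧ A ∩ B ∈ F ∧ A ∪ B ∈ F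

theorem containsBooleanLattice_two_iff {d : ℕ} (F : Finset (Finset (Fin d))) :
    ContainsBooleanLattice 2 F ↔ HasDiamond F := by
  constructor
  · rintro ⟨f, hf, hF⟩
    have hinf : f {0} ∩ f {1} = f ∅ := by
      have := (f.map_inf' ({0} : Finset (Fin 2)) {1}).symm
      simpa using this
    have hsup : f {0} ∪ f {1} = f {0, 1} := by
      have := (f.map_sup' ({0} : Finset (Fin 2)) {1}).symm
      simpa using this
    refine ⟨f {0}, f {1}, fun h => ?_, fun h => ?_, hF _, hF _, hinf ▸ hF _, hsup ▸ hF _⟩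
    · rw [Finset.inter_eq_left.2 h] at hinf
      exact absurd (hf hinf) (by decide)
    · rw [Finset.inter_eq_right.2 h] at hinf
      exact absurd (hf hinf) (by decide)
  · rintro ⟨A, B, hAB, hBA, hA, hB, hI, hU⟩
    obtain ⟨x, hxA, hxB⟩ := Finset.not_subset.1 hAB
    obtain ⟨y, hyB, hyA⟩ := Finset.not_subset.1 hBA
    let g : Finset (Fin 2) → Finset (Fin d) := fun T =>
      A ∩ B ∪ ((if (0 : Fin 2) ∈ T then A else ∅) ∪ (if (1 : Fin 2) ∈ T then B else ∅))
    have hg : ∀ T z, z ∈ g T ↔ (z ∈ A ∧ z ∈ B) ∨ (0 ∈ T ∧ z ∈ A) ∨ (1 ∈ T ∧ z ∈ B) := by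
      intro T z
      by_cases h0 : (0 : Fin 2) ∈ T <;> by_cases h1 : (1 : Fin 2) ∈ T <;> simp [g, h0, h1]
    refine ⟨⟨⟨g, fun S T => ?_⟩, fun S T => ?_⟩, fun S T h => ?_, fun T => ?_⟩
    · ext z
      simp only [Finset.sup_eq_union, Finset.mem_union, hg]
      tauto
    · ext z
      simp only [Finset.inf_eq_inter, Finset.mem_inter, hg]
      tauto
    · have h' : g S = g T := h
      have hx : x ∈ g S ↔ x ∈ g T := by rw [h']
      have hy : y ∈ g S ↔ y ∈ g T := by rw [h']
      simp only [hg, hxA, hxB, hyA, hyB] at hx hy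
      ext i
      fin_cases i
      · simpa using hx
      · simpa using hy
    · change g T ∈ F
      by_cases h0 : (0 : Fin 2) ∈ T <;> by_cases h1 : (1 : Fin 2) ∈ T
      · have : g T = A ∪ B := by ext z; simp only [hg, h0, h1, Finset.mem_union]; tauto
        rwa [this]
      · have : g T = A := by ext z; simp only [hg, h0, h1]; tauto
        rwa [this]
      · have : g T = B := by ext z; simp only [hg, h0, h1]; tauto
        rwa [this]
      · have : g T = A ∩ B := by ext z; simp only [hg, h0, h1, Finset.mem_inter]; tauto
        rwa [this]

theorem card_le_genSperner_two {d : ℕ} {F : Finset (Finset (Fin d))} (hF : ¬ HasDiamond F) :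
    F.card ≤ genSperner d 2 := by
  classical
  unfold genSperner
  refine Finset.le_sup (f := Finset.card) ?_
  simpa [containsBooleanLattice_two_iff] using hF

theorem genSperner_two_le {d n : ℕ}
    (h : ∀ F : Finset (Finset (Fin d)), ¬ HasDiamond F → F.card ≤ n) : genSperner d 2 ≤ n := by
  classical
  unfold genSperner
  refine Finset.sup_le fun F hF => h F ?_
  simpa [containsBooleanLattice_two_iff] using hF

theorem exists_card_eq_genSperner_two (d : ℕ) :
    ∃ F : Finset (Finset (Fin d)), ¬ HasDiamond F ∧ F.card = genSperner d 2 := by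
  classical
  have hne : (Finset.univ.filter fun F : Finset (Finset (Fin d)) =>
      ¬ ContainsBooleanLattice 2 F).Nonempty := by
    refine ⟨∅, ?_⟩
    simp [containsBooleanLattice_two_iff, HasDiamond]
  obtain ⟨F, hF, h⟩ := Finset.exists_mem_eq_sup _ hne Finset.card
  refine ⟨F, by simpa [containsBooleanLattice_two_iff] using hF, ?_⟩
  unfold genSperner
  convert h.symm

/-! ### Sections of a family along one coordinate -/

/-- Split the subsets of `Fin (n + 1)` according to whether they contain `i`. -/
theorem sum_finset_fin_succ {M : Type*} [AddCommMonoid M] {n : ℕ} (i : Fin (n + 1))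
    (g : Finset (Fin (n + 1)) → M) :
    ∑ S, g S = ∑ S : Finset (Fin n), g (S.map i.succAboveEmb) +
      ∑ S : Finset (Fin n), g (insert i (S.map i.succAboveEmb)) := by
  have hi : i ∉ Finset.univ.map i.succAboveEmb := by simp
  have hp : (Finset.univ.map i.succAboveEmb).powerset =
      Finset.univ.map (Finset.mapEmbedding i.succAboveEmb).toEmbedding := by
    ext S
    simp only [Finset.mem_powerset, Finset.mem_map, Finset.mem_univ, true_and,
      Finset.subset_map_iff, RelEmbedding.coe_toEmbedding, Finset.mapEmbedding_apply]
    simp [eq_comm]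
  rw [← Finset.powerset_univ, Fin.univ_succAbove _ i, Finset.cons_eq_insert,
    Finset.sum_powerset_insert hi, hp, Finset.sum_map, Finset.sum_map]
  rfl

/-- The members of `F` avoiding `i`, as subsets of `Fin n`. -/
def lowerSection {n : ℕ} (i : Fin (n + 1)) (F : Finset (Finset (Fin (n + 1)))) :
    Finset (Finset (Fin n)) :=
  Finset.univ.filter fun S => S.map i.succAboveEmb ∈ F

/-- The members of `F` containing `i`, with `i` removed, as subsets of `Fin n`. -/
def upperSection {n : ℕ} (i : Fin (n + 1)) (F : Finset (Finset (Fin (n + 1)))) :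
    Finset (Finset (Fin n)) :=
  Finset.univ.filter fun S => insert i (S.map i.succAboveEmb) ∈ F

section Sections

variable {n : ℕ} {i : Fin (n + 1)} {F : Finset (Finset (Fin (n + 1)))}

theorem mem_lowerSection {S : Finset (Fin n)} :
    S ∈ lowerSection i F ↔ S.map i.succAboveEmb ∈ F := by simp [lowerSection]

theorem mem_upperSection {S : Finset (Fin n)} :
    S ∈ upperSection i F ↔ insert i (S.map i.succAboveEmb) ∈ F := by simp [upperSection]

theorem card_lowerSection_add_card_upperSection (i : Fin (n + 1))
    (F : Finset (Finset (Fin (n + 1)))) :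
    (lowerSection i F).card + (upperSection i F).card = F.card := by
  have := sum_finset_fin_succ i fun S => if S ∈ F then 1 else 0
  simp only [← Finset.sum_filter, Finset.sum_const, smul_eq_mul, mul_one] at this
  simpa [lowerSection, upperSection] using this.symm

theorem notMem_map_succAboveEmb (S : Finset (Fin n)) : i ∉ S.map i.succAboveEmb := by simp

theorem insert_subset_insert_map_iff {S T : Finset (Fin n)} :
    insert i (S.map i.succAboveEmb) ⊆ insert i (T.map i.succAboveEmb) ↔ S ⊆ T := by
  rw [Finset.insert_subset_insert_iff (notMem_map_succAboveEmb S), Finset.map_subset_map]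

theorem not_hasDiamond_lowerSection (hF : ¬ HasDiamond F) : ¬ HasDiamond (lowerSection i F) := by
  rintro ⟨A, B, hAB, hBA, hA, hB, hI, hU⟩
  rw [mem_lowerSection] at *
  rw [Finset.map_inter] at hI
  rw [Finset.map_union] at hU
  exact hF ⟨_, _, by simpa using hAB, by simpa using hBA, hA, hB, hI, hU⟩

theorem not_hasDiamond_upperSection (hF : ¬ HasDiamond F) : ¬ HasDiamond (upperSection i F) := by
  rintro ⟨A, B, hAB, hBA, hA, hB, hI, hU⟩
  rw [mem_upperSection] at *
  rw [Finset.map_inter, Finset.insert_inter_distrib] at hI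
  rw [Finset.map_union, Finset.insert_union_distrib] at hU
  exact hF ⟨_, _, by rwa [insert_subset_insert_map_iff], by rwa [insert_subset_insert_map_iff],
    hA, hB, hI, hU⟩

/-- If S ⊂ T both lay in both sections, then S, T, S ∪ {i}, T ∪ {i} would form a diamond whose
incomparable sets are T and S ∪ {i}. -/
theorem isAntichain_section_inter (hF : ¬ HasDiamond F) :
    IsAntichain (· ⊆ ·) ((lowerSection i F ∩ upperSection i F : Finset _) : Set (Finset (Fin n))) := by
  intro S hS T hT hne hsub
  simp only [Finset.coe_inter, Set.mem_inter_iff, Finset.mem_coe, mem_lowerSection,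
    mem_upperSection] at hS hT
  have hsub' : S.map i.succAboveEmb ⊆ T.map i.succAboveEmb := Finset.map_subset_map.2 hsub
  refine hF ⟨T.map i.succAboveEmb, insert i (S.map i.succAboveEmb), fun h => ?_, fun h => ?_,
    hT.1, hS.2, ?_, ?_⟩
  · rw [Finset.subset_insert_iff_of_notMem (notMem_map_succAboveEmb T),
      Finset.map_subset_map] at h
    exact hne (hsub.antisymm h)
  · exact notMem_map_succAboveEmb T (h (Finset.mem_insert_self _ _))
  · rw [Finset.inter_insert_of_notMem (notMem_map_succAboveEmb T), Finset.inter_eq_right.2 hsub']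
    exact hS.1
  · rw [Finset.union_insert, Finset.union_eq_left.2 hsub']
    exact hT.2

end Sections

/-! ### Bounds and small values of c_d -/

theorem genSperner_two_succ_le_two_mul (n : ℕ) : genSperner (n + 1) 2 ≤ 2 * genSperner n 2 := by
  refine genSperner_two_le fun F hF => ?_
  rw [← card_lowerSection_add_card_upperSection 0 F, two_mul]
  exact add_le_add (card_le_genSperner_two (not_hasDiamond_lowerSection hF))
    (card_le_genSperner_two (not_hasDiamond_upperSection hF))

/-- The sizes of the sections add up to those of their union and their intersection, and the latter
is an antichain. The bound is attained for n ≤ 3. -/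
theorem genSperner_two_succ_le_add_choose (n : ℕ) :
    genSperner (n + 1) 2 ≤ 2 ^ n + n.choose (n / 2) := by
  refine genSperner_two_le fun F hF => ?_
  rw [← card_lowerSection_add_card_upperSection 0 F, ← Finset.card_union_add_card_inter]
  refine add_le_add ((Finset.card_le_univ _).trans (by simp)) ?_
  simpa using (isAntichain_section_inter (i := 0) hF).sperner

/-- In a diamond the sizes satisfy |A| + |B| = |A ∩ B| + |A ∪ B| with strict inequalities between
levels, so a union of layers is safe when `K` has no such relation. -/
theorem le_genSperner_two_of_layers {d m : ℕ} (K : Finset ℕ)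
    (hK : ∀ a ∈ K, ∀ b ∈ K, ∀ u ∈ K, ∀ v ∈ K, u < a → u < b → a < v → b < v → a + b ≠ u + v)
    (hm : m = (Finset.univ.filter fun S : Finset (Fin d) => S.card ∈ K).card) :
    m ≤ genSperner d 2 := by
  rw [hm]
  refine card_le_genSperner_two ?_
  rintro ⟨A, B, hAB, hBA, hA, hB, hI, hU⟩
  simp only [Finset.mem_filter, Finset.mem_univ, true_and] at hA hB hI hU
  have h1 : (A ∩ B).card < A.card := Finset.card_lt_card
    ⟨Finset.inter_subset_left, fun h => hAB (h.trans Finset.inter_subset_right)⟩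
  have h2 : (A ∩ B).card < B.card := Finset.card_lt_card
    ⟨Finset.inter_subset_right, fun h => hBA (h.trans Finset.inter_subset_left)⟩
  have h3 := Finset.card_union_add_card_inter A B
  exact hK _ hA _ hB _ hI _ hU h1 h2 (by omega) (by omega) (by omega)

/-- The general bound gives 22. Equality would force, along every coordinate, sections that cover
everything and share exactly the middle layer; then ∅, {0,1}, {2,3,4} and the whole set all lie in
F. -/
theorem genSperner_five_two_le : genSperner 5 2 ≤ 21 := by
  refine genSperner_two_le fun F hF => ?_
  by_contra! hcard
  have key : ∀ i : Fin 5, (∀ S : Finset (Fin 4), S.map i.succAboveEmb ∈ F ∨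
      insert i (S.map i.succAboveEmb) ∈ F) ∧ ∀ S : Finset (Fin 4),
      (S.map i.succAboveEmb ∈ F ∧ insert i (S.map i.succAboveEmb) ∈ F) ↔ S.card = 2 := by
    intro i
    set I := lowerSection i F ∩ upperSection i F with hI
    set U := lowerSection i F ∪ upperSection i F with hU
    have hanti : IsAntichain (· ⊆ ·) (I : Set (Finset (Fin 4))) := isAntichain_section_inter hF
    have hIU : U.card + I.card = F.card := by
      rw [hU, hI, Finset.card_union_add_card_inter, card_lowerSection_add_card_upperSection]
    have hU16 : U.card ≤ 16 := (Finset.card_le_univ _).trans (by simp)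
    have hI6 : I.card ≤ 6 := by simpa [Nat.choose] using hanti.sperner
    have hUuniv : U = Finset.univ := by
      rw [← Finset.card_eq_iff_eq_univ]
      simp
      omega
    -- Equality in Sperner: a member off the middle layer has LYM weight above 1/6, so six members
    -- would have total weight above 1.
    have hsub : I ⊆ Finset.univ.filter fun S : Finset (Fin 4) => S.card = 2 := by
      by_contra hns
      obtain ⟨S, hS, hS2⟩ := Finset.not_subset.1 hns
      simp only [Finset.mem_filter, Finset.mem_univ, true_and] at hS2
      have hlym := Finset.lubell_yamamoto_meshalkin_inequality_sum_inv_choose (𝕜 := ℚ) hanti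
      simp only [Fintype.card_fin] at hlym
      have hle : ∀ T ∈ I, (1 / 6 : ℚ) ≤ ((Nat.choose 4 T.card : ℕ) : ℚ)⁻¹ := by
        intro T _
        have : T.card ≤ 4 := by simpa using T.card_le_univ
        interval_cases T.card <;> norm_num [Nat.choose]
      have hlt : (1 / 6 : ℚ) < ((Nat.choose 4 S.card : ℕ) : ℚ)⁻¹ := by
        have : S.card ≤ 4 := by simpa using S.card_le_univ
        interval_cases S.card <;> first | omega | norm_num [Nat.choose]
      have := Finset.sum_lt_sum hle ⟨S, hS, hlt⟩
      rw [Finset.sum_const, show I.card = 6 by omega] at this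
      norm_num at this
      linarith
    have hIeq := Finset.eq_of_subset_of_card_le hsub (by
      rw [show (Finset.univ.filter fun S : Finset (Fin 4) => S.card = 2).card = 6 by decide]
      omega)
    refine ⟨fun S => ?_, fun S => ?_⟩
    · have : S ∈ U := hUuniv ▸ Finset.mem_univ S
      simpa [hU, mem_lowerSection, mem_upperSection] using this
    · have : S ∈ I ↔ S.card = 2 := by rw [hIeq]; simp
      simpa [hI, mem_lowerSection, mem_upperSection] using this
  have pair : {0, 1} ∈ F := by
    have := (((key 4).2 {0, 1}).2 (by decide)).1
    exact (show Finset.map (Fin.succAboveEmb (4 : Fin 5)) {0, 1} = {0, 1} by decide) ▸ this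
  have triple : {2, 3, 4} ∈ F := by
    have := (((key 4).2 {2, 3}).2 (by decide)).2
    exact (show insert 4 (Finset.map (Fin.succAboveEmb (4 : Fin 5)) {2, 3}) = {2, 3, 4} by
      decide) ▸ this
  -- Since {0,1} is in F, having {0} too would put a singleton in both sections along 1, where only
  -- pairs are allowed.
  have single : {0} ∉ F := by
    intro h
    have := ((key 1).2 {0}).1 ⟨(show {0} = Finset.map (Fin.succAboveEmb (1 : Fin 5)) {0} by
      decide) ▸ h, (show {0, 1} = insert 1 (Finset.map (Fin.succAboveEmb (1 : Fin 5)) {0}) by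
      decide) ▸ pair⟩
    exact absurd this (by decide)
  have quad : {1, 2, 3, 4} ∉ F := by
    intro h
    have := ((key 1).2 {1, 2, 3}).1 ⟨(show {2, 3, 4} = Finset.map (Fin.succAboveEmb (1 : Fin 5))
      {1, 2, 3} by decide) ▸ triple, (show {1, 2, 3, 4} = insert 1 (Finset.map
      (Fin.succAboveEmb (1 : Fin 5)) {1, 2, 3}) by decide) ▸ h⟩
    exact absurd this (by decide)
  have hempty : ∅ ∈ F := by
    rcases (key 0).1 ∅ with h | h
    · simpa using h
    · exact absurd h single
  have huniv : Finset.univ ∈ F := by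
    rcases (key 0).1 Finset.univ with h | h
    · exact absurd ((show Finset.map (Fin.succAboveEmb (0 : Fin 5)) Finset.univ = {1, 2, 3, 4} by
        decide) ▸ h) quad
    · exact (show insert 0 (Finset.map (Fin.succAboveEmb (0 : Fin 5)) Finset.univ) = Finset.univ by
        decide) ▸ h
  exact hF ⟨{0, 1}, {2, 3, 4}, by decide, by decide, pair, triple,
    (show ({0, 1} ∩ {2, 3, 4} : Finset (Fin 5)) = ∅ by decide) ▸ hempty,
    (show ({0, 1} ∪ {2, 3, 4} : Finset (Fin 5)) = Finset.univ by decide) ▸ huniv⟩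

theorem genSperner_zero_two : genSperner 0 2 = 1 :=
  le_antisymm (genSperner_two_le fun F _ => (Finset.card_le_univ F).trans (by simp))
    (le_genSperner_two_of_layers {0} (by decide) (by decide))

theorem genSperner_one_two : genSperner 1 2 = 2 :=
  le_antisymm (genSperner_two_succ_le_add_choose 0)
    (le_genSperner_two_of_layers {0, 1} (by decide) (by decide))

theorem genSperner_two_two : genSperner 2 2 = 3 :=
  le_antisymm (genSperner_two_succ_le_add_choose 1)
    (le_genSperner_two_of_layers {0, 1} (by decide) (by decide))

theorem genSperner_three_two : genSperner 3 2 = 6 :=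
  le_antisymm (genSperner_two_succ_le_add_choose 2)
    (le_genSperner_two_of_layers {1, 2} (by decide) (by decide))

theorem genSperner_four_two : genSperner 4 2 = 11 :=
  le_antisymm (genSperner_two_succ_le_add_choose 3)
    (le_genSperner_two_of_layers {1, 2, 4} (by decide) (by decide))

theorem genSperner_five_two : genSperner 5 2 = 21 :=
  le_antisymm genSperner_five_two_le
    (le_genSperner_two_of_layers {0, 2, 3} (by decide) (by decide))

/-- The upper bound for `genSperner 8 2` prevents it from being `8 * 21`. -/
theorem exists_genSperner_two_succ_lt :
    ∃ d, 5 ≤ d ∧ d < 8 ∧ genSperner (d + 1) 2 < 2 * genSperner d 2 := by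
  by_contra! h
  have h5 := h 5 (by norm_num) (by norm_num)
  have h6 := h 6 (by norm_num) (by norm_num)
  have h7 := h 7 (by norm_num) (by norm_num)
  -- Three doublings would give at least 168, against 128 + 35 = 163.
  have h8 := genSperner_two_succ_le_add_choose 7
  have hc : Nat.choose 7 (7 / 2) = 35 := by decide
  rw [hc] at h8
  rw [genSperner_five_two] at h5
  norm_num at h5 h6 h7 h8
  omega

/-! ### Products of distinct primes and geometric squares -/

/-- The product of the primes indexed by `S`. -/
noncomputable def primeProd {d : ℕ} (S : Finset (Fin d)) : ℕ :=
  ∏ i ∈ S, Nat.nth Nat.Prime i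

section PrimeProd

variable {d : ℕ}

theorem primeProd_pos (S : Finset (Fin d)) : 0 < primeProd S :=
  Finset.prod_pos fun _ _ => (Nat.prime_nth_prime _).pos

theorem nth_prime_injective : Function.Injective (Nat.nth Nat.Prime) :=
  Nat.nth_injective Nat.infinite_setOfPred_prime

theorem factorization_primeProd (S : Finset (Fin d)) (i : Fin d) :
    (primeProd S).factorization (Nat.nth Nat.Prime i) = if i ∈ S then 1 else 0 := by
  unfold primeProd
  rw [Nat.factorization_prod (g := fun j : Fin d => Nat.nth Nat.Prime j)
    fun j _ => (Nat.prime_nth_prime j).ne_zero, Finset.sum_apply']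
  simp_rw [(Nat.prime_nth_prime _).factorization, Finsupp.single_apply,
    nth_prime_injective.eq_iff, Fin.val_inj]
  simp

theorem primeProd_injective : Function.Injective (primeProd (d := d)) := by
  intro S T h
  ext i
  have := congrArg (fun n => n.factorization (Nat.nth Nat.Prime i)) h
  simp only [factorization_primeProd] at this
  by_cases hS : i ∈ S <;> by_cases hT : i ∈ T <;> simp_all

theorem primeProd_mul_of_disjoint {S T : Finset (Fin d)} (h : Disjoint S T) :
    primeProd (S ∪ T) = primeProd S * primeProd T :=
  Finset.prod_union h

theorem one_lt_primeProd {S : Finset (Fin d)} (h : S.Nonempty) : 1 < primeProd S := by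
  obtain ⟨i, hi⟩ := h
  refine lt_of_lt_of_le (Nat.prime_nth_prime i).one_lt
    (Nat.le_of_dvd (primeProd_pos S) (Finset.dvd_prod_of_mem _ hi))

theorem subset_of_primeProd_dvd {S T : Finset (Fin d)} (h : primeProd S ∣ primeProd T) :
    S ⊆ T := by
  intro i hi
  have := (Nat.factorization_le_iff_dvd (primeProd_pos S).ne' (primeProd_pos T).ne').2 h
    (Nat.nth Nat.Prime i)
  simp only [factorization_primeProd, hi, if_true] at this
  by_contra hT
  simp [hT] at this

theorem primeCube_eq_image (d : ℕ) :
    primeCube d = Finset.univ.image (primeProd (d := d)) := by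
  ext n
  simp only [primeCube, Finset.mem_image, Finset.mem_univ, true_and]
  constructor
  · rintro ⟨e, rfl⟩
    refine ⟨Finset.univ.filter fun i => e i = 1, ?_⟩
    rw [primeProd, Finset.prod_filter]
    refine Finset.prod_congr rfl fun i _ => ?_
    rcases Fin.exists_fin_two.1 ⟨e i, rfl⟩ with h | h <;> simp [h]
  · rintro ⟨S, rfl⟩
    refine ⟨fun i => if i ∈ S then 1 else 0, ?_⟩
    have h : primeProd S = ∏ i, if i ∈ S then Nat.nth Nat.Prime i else 1 := by
      rw [Finset.prod_ite_mem, Finset.univ_inter, primeProd]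
    rw [h]
    refine Finset.prod_congr rfl fun i _ => ?_
    by_cases hi : i ∈ S <;> simp [hi]

/-- A dilate of the prime cube meets a set without geometric squares in a family of subsets
without diamonds. -/
theorem not_hasDiamond_dilate {A : Finset ℕ} (hA : Avoids geometricSquares A) {x : ℕ}
    (hx : 0 < x) :
    ¬ HasDiamond (Finset.univ.filter fun S : Finset (Fin d) => x * primeProd S ∈ A) := by
  rintro ⟨S, T, hST, hTS, hS, hT, hI, hU⟩
  simp only [Finset.mem_filter, Finset.mem_univ, true_and] at hS hT hI hU
  have e1 : x * primeProd S = x * primeProd (S ∩ T) * primeProd (S \ T) := by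
    rw [mul_assoc, ← primeProd_mul_of_disjoint, Finset.union_comm, Finset.sdiff_union_inter]
    exact (Finset.disjoint_sdiff_inter S T).symm
  have e2 : x * primeProd T = x * primeProd (S ∩ T) * primeProd (T \ S) := by
    rw [mul_assoc, ← primeProd_mul_of_disjoint, Finset.union_comm, Finset.inter_comm,
      Finset.sdiff_union_inter]
    rw [Finset.inter_comm]
    exact (Finset.disjoint_sdiff_inter T S).symm
  have e3 : x * primeProd (S ∪ T) =
      x * primeProd (S ∩ T) * primeProd (S \ T) * primeProd (T \ S) := by
    rw [← e1, mul_assoc, ← primeProd_mul_of_disjoint Finset.disjoint_sdiff,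
      Finset.union_sdiff_self_eq_union]
  have hr := one_lt_primeProd (Finset.sdiff_nonempty.2 hST)
  have hs := one_lt_primeProd (Finset.sdiff_nonempty.2 hTS)
  have ha : 1 ≤ x * primeProd (S ∩ T) := Nat.mul_pos hx (primeProd_pos _)
  rw [e1] at hS
  rw [e2] at hT
  rw [e3] at hU
  -- The ratios r and s of a geometric square must differ; here they come from disjoint nonempty
  -- sets of primes.
  have hne : primeProd (S \ T) ≠ primeProd (T \ S) := by
    intro h
    obtain ⟨i, hi⟩ := Finset.sdiff_nonempty.2 hST
    have hi' := primeProd_injective h ▸ hi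
    exact (Finset.mem_sdiff.1 hi').2 (Finset.mem_sdiff.1 hi).1
  rcases hne.lt_or_gt with h | h
  · refine hA _ ⟨_, _, _, ha, hr, h, rfl⟩ ?_
    rintro y (rfl | rfl | rfl | rfl) <;> assumption
  · refine hA _ ⟨_, _, _, ha, hs, h, rfl⟩ ?_
    rw [mul_right_comm] at hU
    rintro y (rfl | rfl | rfl | rfl) <;> assumption

theorem avoids_image_primeProd {F : Finset (Finset (Fin d))} (hF : ¬ HasDiamond F) :
    Avoids geometricSquares (F.image primeProd) := by
  rintro B ⟨a, r, s, ha, hr, hrs, rfl⟩ hB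
  have hmem : ∀ y ∈ ({a, a * r, a * s, a * r * s} : Set ℕ), ∃ S ∈ F, primeProd S = y :=
    fun y hy => by simpa using hB hy
  obtain ⟨S₀, h₀, e₀⟩ := hmem a (by simp)
  obtain ⟨S₁, h₁, e₁⟩ := hmem (a * r) (by simp)
  obtain ⟨S₂, h₂, e₂⟩ := hmem (a * s) (by simp)
  obtain ⟨S₃, h₃, e₃⟩ := hmem (a * r * s) (by simp)
  have h01 : S₀ ⊆ S₁ := subset_of_primeProd_dvd (by rw [e₀, e₁]; exact dvd_mul_right _ _)
  have h02 : S₀ ⊆ S₂ := subset_of_primeProd_dvd (by rw [e₀, e₂]; exact dvd_mul_right _ _)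
  have hmul : primeProd S₁ * primeProd S₂ = primeProd S₀ * primeProd S₃ := by
    rw [e₀, e₁, e₂, e₃]; ring
  -- Comparing exponents of each prime in (ar)(as) = a(ars) determines the intersection and the
  -- union.
  have hcount : ∀ i, (if i ∈ S₁ then 1 else 0) + (if i ∈ S₂ then 1 else 0) =
      (if i ∈ S₀ then 1 else 0) + (if i ∈ S₃ then 1 else 0) := by
    intro i
    have := congrArg (fun n => n.factorization (Nat.nth Nat.Prime i)) hmul
    simpa only [Nat.factorization_mul (primeProd_pos _).ne' (primeProd_pos _).ne',
      Finsupp.add_apply, factorization_primeProd] using this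
  have hinter : S₁ ∩ S₂ = S₀ := by
    ext i
    have := hcount i
    have h01' := @h01 i
    have h02' := @h02 i
    by_cases i ∈ S₀ <;> by_cases i ∈ S₁ <;> by_cases i ∈ S₂ <;> by_cases i ∈ S₃ <;> simp_all
  have hunion : S₁ ∪ S₂ = S₃ := by
    ext i
    have := hcount i
    have h01' := @h01 i
    have h02' := @h02 i
    by_cases i ∈ S₀ <;> by_cases i ∈ S₁ <;> by_cases i ∈ S₂ <;> by_cases i ∈ S₃ <;> simp_all
  refine hF ⟨S₁, S₂, fun h => ?_, fun h => ?_, h₁, h₂, hinter ▸ h₀, hunion ▸ h₃⟩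
  · rw [Finset.inter_eq_left.2 h] at hinter
    rw [hinter, e₀] at e₁
    nlinarith
  · rw [Finset.inter_eq_right.2 h] at hinter
    rw [hinter, e₀] at e₂
    nlinarith

end PrimeProd

/-! ### Extremal sizes for the prime cube and for intervals -/

theorem card_le_maxAvoid {𝒜 : Set (Set ℕ)} {A X : Finset ℕ} (hAX : A ⊆ X) (hA : Avoids 𝒜 A) :
    A.card ≤ maxAvoid 𝒜 X := by
  classical
  unfold maxAvoid
  exact Finset.le_sup (f := Finset.card) (by simp [hAX, hA])

theorem maxAvoid_le {𝒜 : Set (Set ℕ)} {X : Finset ℕ} {n : ℕ}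
    (h : ∀ A ⊆ X, Avoids 𝒜 A → A.card ≤ n) : maxAvoid 𝒜 X ≤ n := by
  classical
  unfold maxAvoid
  refine Finset.sup_le fun A hA => ?_
  simp only [Finset.mem_filter, Finset.mem_powerset] at hA
  exact h A hA.1 hA.2

theorem maxAvoid_primeCube (d : ℕ) :
    maxAvoid geometricSquares (primeCube d) = genSperner d 2 := by
  apply le_antisymm
  · refine maxAvoid_le fun A hAX hA => ?_
    refine le_trans ?_ (card_le_genSperner_two (not_hasDiamond_dilate (d := d) hA one_pos))
    refine (Finset.card_le_card ?_).trans (Finset.card_image_le (f := primeProd))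
    intro y hy
    obtain ⟨S, -, rfl⟩ := Finset.mem_image.1 (primeCube_eq_image d ▸ hAX hy)
    exact Finset.mem_image_of_mem _ (by simpa using hy)
  · obtain ⟨F, hF, hcard⟩ := exists_card_eq_genSperner_two d
    rw [← hcard, ← Finset.card_image_of_injective F primeProd_injective]
    refine card_le_maxAvoid ?_ (avoids_image_primeProd hF)
    rw [primeCube_eq_image]
    exact Finset.image_subset_image (Finset.subset_univ _)

/-- The extreme members of a geometric square have ratio rs ≥ 2·3. -/
theorem avoids_Ioc_div_six (n : ℕ) : Avoids geometricSquares (Finset.Ioc (n / 6) n) := by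
  rintro B ⟨a, r, s, ha, hr, hrs, rfl⟩ hB
  have h1 := hB (show a ∈ _ by simp)
  have h2 := hB (show a * r * s ∈ _ by simp)
  simp only [Finset.coe_Ioc, Set.mem_Ioc] at h1 h2
  have h3 : a * 6 ≤ a * r * s := by
    rw [mul_assoc]
    exact Nat.mul_le_mul_left _ (Nat.mul_le_mul (show 2 ≤ r from hr) (show 3 ≤ s by omega))
  omega

theorem five_mul_le_six_mul_maxAvoid (n : ℕ) :
    5 * n ≤ 6 * maxAvoid geometricSquares (Finset.Icc 1 n) := by
  have := card_le_maxAvoid (X := Finset.Icc 1 n) (fun x hx => by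
    simp only [Finset.mem_Ioc, Finset.mem_Icc] at hx ⊢; omega) (avoids_Ioc_div_six n)
  rw [Nat.card_Ioc] at this
  omega

theorem maxAvoid_Icc_le (𝒜 : Set (Set ℕ)) (n : ℕ) : maxAvoid 𝒜 (Finset.Icc 1 n) ≤ n :=
  maxAvoid_le fun A hA _ => by simpa using Finset.card_le_card hA

/-! ### Bases of the dilated cubes -/

theorem primorialFirst_zero : primorialFirst 0 = 1 := by simp [primorialFirst]

theorem primorialFirst_succ (d : ℕ) :
    primorialFirst (d + 1) = primorialFirst d * Nat.nth Nat.Prime d := by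
  simp [primorialFirst, Fin.prod_univ_castSucc]

theorem primorialFirst_pos (d : ℕ) : 0 < primorialFirst d :=
  Finset.prod_pos fun _ _ => (Nat.prime_nth_prime _).pos

theorem two_dvd_primorialFirst_succ (d : ℕ) : 2 ∣ primorialFirst (d + 1) := by
  rw [primorialFirst, ← Nat.nth_prime_zero_eq_two]
  exact Finset.dvd_prod_of_mem (fun i : Fin (d + 1) => Nat.nth Nat.Prime i) (Finset.mem_univ 0)

theorem coprime_nth_prime_primorialFirst (d : ℕ) :
    (Nat.nth Nat.Prime d).Coprime (primorialFirst d) := by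
  refine Nat.Coprime.prod_right fun i _ => ?_
  rw [Nat.coprime_primes (Nat.prime_nth_prime _) (Nat.prime_nth_prime _)]
  exact fun h => i.2.ne' (nth_prime_injective h)

/-- `x` is a power of `4` with exponent less than `J` times a number coprime to `P_d`. -/
def IsCubeBase (J d x : ℕ) : Prop :=
  ∃ j < J, ∃ b : ℕ, b.Coprime (primorialFirst d) ∧ x = 4 ^ j * b

theorem isCubeBase_zero {J x : ℕ} (hJ : 0 < J) : IsCubeBase J 0 x :=
  ⟨0, hJ, x, by simp [primorialFirst_zero], by simp⟩

theorem IsCubeBase.of_succ {J d x : ℕ} (h : IsCubeBase J (d + 1) x) : IsCubeBase J d x := by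
  obtain ⟨j, hj, b, hb, rfl⟩ := h
  rw [primorialFirst_succ] at hb
  exact ⟨j, hj, b, hb.coprime_mul_right_right, rfl⟩

theorem IsCubeBase.mul_nth_prime {J d x : ℕ} (h : IsCubeBase J (d + 1) x) :
    IsCubeBase J d (x * Nat.nth Nat.Prime d) := by
  obtain ⟨j, hj, b, hb, rfl⟩ := h
  rw [primorialFirst_succ] at hb
  exact ⟨j, hj, b * Nat.nth Nat.Prime d,
    hb.coprime_mul_right_right.mul_left (coprime_nth_prime_primorialFirst d), by ring⟩

theorem IsCubeBase.even_factorization {J d x : ℕ} (h : IsCubeBase J (d + 1) x) (hx : x ≠ 0) :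
    Even (x.factorization (Nat.nth Nat.Prime d)) := by
  obtain ⟨j, hj, b, hb, rfl⟩ := h
  rw [primorialFirst_succ] at hb
  have hp := Nat.prime_nth_prime d
  have hb0 : b ≠ 0 := right_ne_zero_of_mul hx
  have hbp : b.factorization (Nat.nth Nat.Prime d) = 0 :=
    Nat.factorization_eq_zero_of_not_dvd
      ((Nat.Prime.coprime_iff_not_dvd hp).1 hb.coprime_mul_left_right.symm)
  rw [Nat.factorization_mul (by positivity) hb0, Finsupp.add_apply, hbp,
    show 4 = 2 ^ 2 by norm_num, ← pow_mul, Nat.factorization_pow, Finsupp.smul_apply, add_zero,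
    smul_eq_mul, mul_assoc]
  exact even_two_mul _

/-- The valuation at the new prime is even on bases (2j for the prime 2, and 0 for the others), so
multiplying by that prime leaves the set of bases. -/
theorem IsCubeBase.mul_nth_prime_ne {J d x y : ℕ} (hx : IsCubeBase J (d + 1) x)
    (hy : IsCubeBase J (d + 1) y) (hx0 : x ≠ 0) : x * Nat.nth Nat.Prime d ≠ y := by
  rintro rfl
  have hp := Nat.prime_nth_prime d
  have h := hy.even_factorization (mul_ne_zero hx0 hp.ne_zero)
  rw [Nat.factorization_mul hx0 hp.ne_zero, Finsupp.add_apply, hp.factorization_self,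
    Nat.even_add_one] at h
  exact h (hx.even_factorization hx0)

open Classical in
/-- The points `x` at which a dilate `x * a_d` of the prime cube inside `[n]` is placed. -/
noncomputable def cubeBases (J d n : ℕ) : Finset ℕ :=
  (Finset.Icc 1 n).filter fun x => IsCubeBase J d x ∧ x * primorialFirst d ≤ n

theorem mem_cubeBases {J d n x : ℕ} :
    x ∈ cubeBases J d n ↔ 0 < x ∧ IsCubeBase J d x ∧ x * primorialFirst d ≤ n := by
  simp only [cubeBases, Finset.mem_filter, Finset.mem_Icc, Nat.succ_le_iff]
  refine ⟨fun h => ⟨h.1.1, h.2⟩, fun h => ⟨⟨h.1, ?_⟩, h.2⟩⟩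
  exact (Nat.le_mul_of_pos_right x (primorialFirst_pos d)).trans h.2.2

theorem cubeBases_zero {J n : ℕ} (hJ : 0 < J) : cubeBases J 0 n = Finset.Icc 1 n := by
  ext x
  simp [mem_cubeBases, isCubeBase_zero hJ, primorialFirst_zero, Nat.succ_le_iff]

/-! ### Merging cubes and telescoping -/

/-- The number of elements of `A` in the dilate `x * a_d`. -/
noncomputable def dilateCard (A : Finset ℕ) (d x : ℕ) : ℕ :=
  ((Finset.univ : Finset (Finset (Fin d))).filter fun S => x * primeProd S ∈ A).card

theorem dilateCard_le {A : Finset ℕ} (hA : Avoids geometricSquares A) {x : ℕ} (hx : 0 < x)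
    (d : ℕ) : dilateCard A d x ≤ genSperner d 2 :=
  card_le_genSperner_two (not_hasDiamond_dilate hA hx)

theorem dilateCard_zero (A : Finset ℕ) (x : ℕ) : dilateCard A 0 x = if x ∈ A then 1 else 0 := by
  have h1 : ∀ S : Finset (Fin 0), primeProd S = 1 := fun S => by
    rw [Subsingleton.elim S ∅, primeProd, Finset.prod_empty]
  simp only [dilateCard, Finset.card_filter, h1, mul_one]
  simp

theorem dilateCard_succ (A : Finset ℕ) (d x : ℕ) :
    dilateCard A (d + 1) x = dilateCard A d x + dilateCard A d (x * Nat.nth Nat.Prime d) := by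
  have hmap : ∀ S : Finset (Fin d),
      primeProd (S.map (Fin.last d).succAboveEmb) = primeProd S := by
    intro S
    simp [primeProd]
  have hins : ∀ S : Finset (Fin d), primeProd (insert (Fin.last d)
      (S.map (Fin.last d).succAboveEmb)) = Nat.nth Nat.Prime d * primeProd S := by
    intro S
    rw [← hmap S, primeProd, Finset.prod_insert (notMem_map_succAboveEmb S), Fin.val_last]
    rfl
  simp only [dilateCard, Finset.card_filter]
  rw [sum_finset_fin_succ (Fin.last d)]
  simp only [hmap, hins, mul_assoc]

/-- The next level's bases I' and their multiples p·I' are disjoint inside I, and each pair merges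
into one larger cube. The remaining |I| − 2|I'| cubes hold at most c_d points each. -/
theorem sum_dilateCard_le {A : Finset ℕ} (hA : Avoids geometricSquares A) (J d n : ℕ) :
    ∑ x ∈ cubeBases J d n, dilateCard A d x +
        2 * genSperner d 2 * (cubeBases J (d + 1) n).card ≤
      ∑ x ∈ cubeBases J (d + 1) n, dilateCard A (d + 1) x +
        genSperner d 2 * (cubeBases J d n).card := by
  set I := cubeBases J d n
  set I' := cubeBases J (d + 1) n
  set p := Nat.nth Nat.Prime d with hp
  have hp0 : 0 < p := (Nat.prime_nth_prime d).pos
  have hinj : Function.Injective (· * p) := fun a b h => Nat.eq_of_mul_eq_mul_right hp0 h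
  have hdisj : Disjoint I' (I'.image (· * p)) := by
    rw [Finset.disjoint_right]
    intro y hy hy'
    obtain ⟨x, hx, rfl⟩ := Finset.mem_image.1 hy
    rw [mem_cubeBases] at hx hy'
    exact hx.2.1.mul_nth_prime_ne hy'.2.1 hx.1.ne' rfl
  have hsub : I' ∪ I'.image (· * p) ⊆ I := by
    intro y hy
    rcases Finset.mem_union.1 hy with hy | hy
    · obtain ⟨h1, h2, h3⟩ := mem_cubeBases.1 hy
      refine mem_cubeBases.2 ⟨h1, h2.of_succ, le_trans ?_ h3⟩
      rw [primorialFirst_succ, ← mul_assoc]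
      exact Nat.le_mul_of_pos_right _ hp0
    · obtain ⟨x, hx, rfl⟩ := Finset.mem_image.1 hy
      obtain ⟨h1, h2, h3⟩ := mem_cubeBases.1 hx
      refine mem_cubeBases.2 ⟨Nat.mul_pos h1 hp0, h2.mul_nth_prime, le_of_eq_of_le ?_ h3⟩
      rw [primorialFirst_succ]
      ring
  have hcard : (I' ∪ I'.image (· * p)).card = 2 * I'.card := by
    rw [Finset.card_union_of_disjoint hdisj, Finset.card_image_of_injective _ hinj, two_mul]
  have hsum : ∑ x ∈ I' ∪ I'.image (· * p), dilateCard A d x =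
      ∑ x ∈ I', dilateCard A (d + 1) x := by
    rw [Finset.sum_union hdisj, Finset.sum_image hinj.injOn, ← Finset.sum_add_distrib]
    exact Finset.sum_congr rfl fun x _ => (dilateCard_succ A d x).symm
  have hrest : ∑ x ∈ I \ (I' ∪ I'.image (· * p)), dilateCard A d x ≤
      (I \ (I' ∪ I'.image (· * p))).card * genSperner d 2 := by
    refine Finset.sum_le_card_nsmul _ _ _ fun x hx => dilateCard_le hA ?_ d
    exact (mem_cubeBases.1 (Finset.mem_sdiff.1 hx).1).1
  rw [← Finset.sum_sdiff hsub, hsum, ← Finset.card_sdiff_add_card_eq_card hsub, hcard]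
  nlinarith

/-- The deficiency `2 c_{d,2,2} - c_{d+1,2,2}`. -/
noncomputable def spernerDeficiency (d : ℕ) : ℝ :=
  2 * (genSperner d 2 : ℝ) - (genSperner (d + 1) 2 : ℝ)

theorem spernerDeficiency_nonneg (d : ℕ) : 0 ≤ spernerDeficiency d := by
  have : (genSperner (d + 1) 2 : ℝ) ≤ 2 * genSperner d 2 := by
    exact_mod_cast genSperner_two_succ_le_two_mul d
  unfold spernerDeficiency
  linarith

theorem card_add_sum_deficiency_le {A : Finset ℕ} (hA : Avoids geometricSquares A) {J n : ℕ}
    (hJ : 0 < J) (hAn : A ⊆ Finset.Icc 1 n) (D : ℕ) :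
    (A.card : ℝ) + ∑ d ∈ Finset.range D, spernerDeficiency d * (cubeBases J (d + 1) n).card ≤ n := by
  -- The invariant bounds the savings so far by the slack left in the level-D cubes; at D = 0 it is
  -- an equality, as c_0 = 1.
  have key : (A.card : ℝ) +
      ∑ d ∈ Finset.range D, spernerDeficiency d * (cubeBases J (d + 1) n).card +
        genSperner D 2 * (cubeBases J D n).card ≤
      n + ((∑ x ∈ cubeBases J D n, dilateCard A D x : ℕ) : ℝ) := by
    induction D with
    | zero =>
      have h : ∑ x ∈ Finset.Icc 1 n, dilateCard A 0 x = A.card := by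
        simp only [dilateCard_zero, Finset.sum_ite_mem, Finset.inter_eq_right.2 hAn]
        simp
      rw [cubeBases_zero hJ, h, genSperner_zero_two]
      simp [add_comm]
    | succ D ih =>
      have h : (((∑ x ∈ cubeBases J D n, dilateCard A D x : ℕ) : ℝ)) +
          2 * genSperner D 2 * (cubeBases J (D + 1) n).card ≤
          ((∑ x ∈ cubeBases J (D + 1) n, dilateCard A (D + 1) x : ℕ) : ℝ) +
          genSperner D 2 * (cubeBases J D n).card := by
        exact_mod_cast sum_dilateCard_le hA J D n
      rw [Finset.sum_range_succ]
      unfold spernerDeficiency at ih ⊢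
      linarith
  have hle : ((∑ x ∈ cubeBases J D n, dilateCard A D x : ℕ) : ℝ) ≤
      genSperner D 2 * (cubeBases J D n).card := by
    have : ∑ x ∈ cubeBases J D n, dilateCard A D x ≤
        (cubeBases J D n).card * genSperner D 2 :=
      Finset.sum_le_card_nsmul _ _ _ fun x hx => dilateCard_le hA (mem_cubeBases.1 hx).1 D
    rw [mul_comm]
    exact_mod_cast this
  linarith

theorem maxAvoid_add_sum_deficiency_le {J : ℕ} (hJ : 0 < J) (n D : ℕ) :
    (maxAvoid geometricSquares (Finset.Icc 1 n) : ℝ) +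
      ∑ d ∈ Finset.range D, spernerDeficiency d * (cubeBases J (d + 1) n).card ≤ n := by
  classical
  have hne : ((Finset.Icc 1 n).powerset.filter (Avoids geometricSquares)).Nonempty := by
    refine ⟨∅, ?_⟩
    simp only [Finset.mem_filter, Finset.mem_powerset, Finset.empty_subset, true_and]
    rintro B ⟨a, r, s, -, -, -, rfl⟩ hB
    simpa using hB (show a ∈ _ by simp)
  obtain ⟨A, hA, h⟩ := Finset.exists_mem_eq_sup _ hne Finset.card
  simp only [Finset.mem_filter, Finset.mem_powerset] at hA
  have h' : maxAvoid geometricSquares (Finset.Icc 1 n) = A.card := by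
    unfold maxAvoid
    convert h
  rw [h']
  exact card_add_sum_deficiency_le hA.2 hJ hA.1 D

/-! ### Density of the bases -/

theorem mul_totient_le_card_coprime (P k : ℕ) :
    k * P.totient ≤ ((Finset.Icc 1 (k * P)).filter fun b => P.Coprime b).card := by
  induction k with
  | zero => simp
  | succ k ih =>
    have h : ((Finset.Icc 1 (k * P)).filter fun b => P.Coprime b) ∪
        ((Finset.Ico (k * P + 1) (k * P + 1 + P)).filter fun b => P.Coprime b) ⊆
        (Finset.Icc 1 ((k + 1) * P)).filter fun b => P.Coprime b := by
      rw [← Finset.filter_union]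
      refine Finset.filter_subset_filter _ fun x hx => ?_
      simp only [Finset.mem_union, Finset.mem_Icc, Finset.mem_Ico, add_mul] at hx ⊢
      omega
    refine le_trans ?_ (Finset.card_le_card h)
    rw [Finset.card_union_of_disjoint, Nat.filter_coprime_Ico_eq_totient, add_mul, one_mul]
    · omega
    · refine Finset.disjoint_filter_filter (Finset.disjoint_left.2 fun x hx hx' => ?_)
      simp only [Finset.mem_Icc, Finset.mem_Ico] at hx hx'
      omega

theorem sum_card_coprime_le_card_cubeBases (J d n : ℕ) :
    ∑ j ∈ Finset.range J, ((Finset.Icc 1 (n / (4 ^ j * primorialFirst (d + 1)))).filter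
      fun b => (primorialFirst (d + 1)).Coprime b).card ≤ (cubeBases J (d + 1) n).card := by
  set P := primorialFirst (d + 1)
  rw [← Finset.card_sigma]
  refine Finset.card_le_card_of_injOn (fun x => 4 ^ x.1 * x.2) ?_ ?_
  · rintro ⟨j, b⟩ h
    simp only [Finset.coe_sigma, Set.mem_sigma_iff, Finset.mem_coe, Finset.mem_range,
      Finset.mem_filter, Finset.mem_Icc] at h
    obtain ⟨hj, ⟨hb1, hb2⟩, hb⟩ := h
    refine mem_cubeBases.2 ⟨by positivity, ⟨j, hj, b, hb.symm, rfl⟩, ?_⟩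
    rw [Nat.le_div_iff_mul_le (Nat.mul_pos (by positivity) (primorialFirst_pos _))] at hb2
    calc 4 ^ j * b * P = b * (4 ^ j * P) := by ring
      _ ≤ n := hb2
  · rintro ⟨j, b⟩ h ⟨j', b'⟩ h' heq
    simp only [Finset.coe_sigma, Set.mem_sigma_iff, Finset.mem_coe, Finset.mem_range,
      Finset.mem_filter, Finset.mem_Icc] at h h'
    -- P is even, so b is odd and the 2-adic valuation 2j of 4^j·b recovers j.
    have hodd : ∀ c, P.Coprime c → c.factorization 2 = 0 := fun c hc =>
      Nat.factorization_eq_zero_of_not_dvd ((Nat.Prime.coprime_iff_not_dvd Nat.prime_two).1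
        (hc.coprime_dvd_left (two_dvd_primorialFirst_succ d)))
    have hfac : ∀ i c, 1 ≤ c → P.Coprime c → (4 ^ i * c).factorization 2 = 2 * i := by
      intro i c hc1 hc
      rw [show 4 = 2 ^ 2 by norm_num, ← pow_mul, Nat.factorization_mul (by positivity) (by omega),
        Finsupp.add_apply, hodd c hc, Nat.Prime.factorization_pow Nat.prime_two]
      simp
    have h1 := hfac j b h.2.1.1 h.2.2
    have h2 := hfac j' b' h'.2.1.1 h'.2.2
    simp only at heq
    rw [heq, h2] at h1
    obtain rfl : j' = j := by omega
    obtain rfl : b = b' := Nat.eq_of_mul_eq_mul_left (by positivity) heq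
    rfl

/-- The density `φ(P_d) / P_d ^ 2`, with `d + 1` in place of `d`. -/
noncomputable def cubeDensity (d : ℕ) : ℝ :=
  (Nat.totient (primorialFirst (d + 1)) : ℝ) / (primorialFirst (d + 1) : ℝ) ^ 2

theorem cubeDensity_pos (d : ℕ) : 0 < cubeDensity d := by
  have h1 := primorialFirst_pos (d + 1)
  have h2 := Nat.totient_pos.2 h1
  unfold cubeDensity
  positivity

/-- Rounding down to whole blocks of length P costs at most φ(P) for each j. The error is
independent of n because J is finite. -/
theorem card_cubeBases_ge (J d n : ℕ) :
    cubeDensity d * (∑ j ∈ Finset.range J, (1 / 4 : ℝ) ^ j) * n -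
      2 * J * (Nat.totient (primorialFirst (d + 1)) : ℝ) ≤ (cubeBases J (d + 1) n).card := by
  have h : ((∑ j ∈ Finset.range J, ((Finset.Icc 1 (n / (4 ^ j * primorialFirst (d + 1)))).filter
      fun b => (primorialFirst (d + 1)).Coprime b).card : ℕ) : ℝ) ≤
      (cubeBases J (d + 1) n).card := by
    exact_mod_cast sum_card_coprime_le_card_cubeBases J d n
  refine le_trans ?_ h
  have hP := primorialFirst_pos (d + 1)
  unfold cubeDensity
  set P := primorialFirst (d + 1)
  have hterm : ∀ j ∈ Finset.range J, (P.totient : ℝ) / (P : ℝ) ^ 2 * (1 / 4 : ℝ) ^ j * n -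
      2 * P.totient ≤
      (((Finset.Icc 1 (n / (4 ^ j * P))).filter fun b => P.Coprime b).card : ℝ) := by
    intro j _
    set m := n / (4 ^ j * P) with hm
    have h1 : ((m / P * P.totient : ℕ) : ℝ) ≤
        (((Finset.Icc 1 m).filter fun b => P.Coprime b).card : ℝ) := by
      exact_mod_cast (mul_totient_le_card_coprime P (m / P)).trans (Finset.card_le_card
        (Finset.filter_subset_filter _ (Finset.Icc_subset_Icc_right (Nat.div_mul_le_self m P))))
    refine le_trans ?_ h1
    have hmP : m / P = n / (4 ^ j * P ^ 2) := by
      rw [hm, Nat.div_div_eq_div_mul]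
      ring_nf
    rw [hmP]
    have h2 : (n : ℝ) / (4 ^ j * P ^ 2 : ℕ) < (n / (4 ^ j * P ^ 2) : ℕ) + 1 := by
      rw [← Nat.floor_div_eq_div (K := ℝ)]
      exact Nat.lt_floor_add_one _
    have h3 : (P.totient : ℝ) / (P : ℝ) ^ 2 * (1 / 4 : ℝ) ^ j * n =
        P.totient * ((n : ℝ) / (4 ^ j * P ^ 2 : ℕ)) := by
      push_cast
      field_simp
      rw [mul_right_comm, ← mul_pow]
      norm_num
    rw [h3]
    push_cast at h2 ⊢
    have h0 : (0 : ℝ) ≤ P.totient := Nat.cast_nonneg _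
    nlinarith [mul_le_mul_of_nonneg_left h2.le h0]
  have := Finset.sum_le_sum hterm
  push_cast
  refine le_trans (le_of_eq ?_) this
  rw [Finset.sum_sub_distrib, ← Finset.sum_mul, ← Finset.mul_sum]
  simp
  ring

theorem maxAvoid_Icc_le_sub {J : ℕ} (hJ : 0 < J) (D : ℕ) : ∃ C : ℝ, ∀ n : ℕ,
    (maxAvoid geometricSquares (Finset.Icc 1 n) : ℝ) ≤
      (1 - (∑ j ∈ Finset.range J, (1 / 4 : ℝ) ^ j) *
        ∑ d ∈ Finset.range D, spernerDeficiency d * cubeDensity d) * n + C := by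
  refine ⟨∑ d ∈ Finset.range D,
    spernerDeficiency d * (2 * J * (Nat.totient (primorialFirst (d + 1)) : ℝ)), fun n => ?_⟩
  have h1 := maxAvoid_add_sum_deficiency_le hJ n D
  have h2 := Finset.sum_le_sum fun d (_ : d ∈ Finset.range D) =>
    mul_le_mul_of_nonneg_left (card_cubeBases_ge J d n) (spernerDeficiency_nonneg d)
  simp only [mul_sub, Finset.sum_sub_distrib] at h2
  have h3 : ∑ d ∈ Finset.range D, spernerDeficiency d *
      (cubeDensity d * (∑ j ∈ Finset.range J, (1 / 4 : ℝ) ^ j) * n) =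
      (∑ j ∈ Finset.range J, (1 / 4 : ℝ) ^ j) *
        (∑ d ∈ Finset.range D, spernerDeficiency d * cubeDensity d) * n := by
    rw [Finset.mul_sum, Finset.sum_mul]
    exact Finset.sum_congr rfl fun d _ => by ring
  linarith

/-! ### Passage to the limit and the numerical bound -/

/-- The upper density of the largest sets without geometric squares. -/
noncomputable def squareFreeDensity : ℝ :=
  limsup (fun n : ℕ => (maxAvoid geometricSquares (Finset.Icc 1 n) : ℝ) / (n : ℝ)) atTop

theorem maxAvoid_div_le_one (n : ℕ) :
    (maxAvoid geometricSquares (Finset.Icc 1 n) : ℝ) / n ≤ 1 :=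
  div_le_one_of_le₀ (by exact_mod_cast maxAvoid_Icc_le _ n) (Nat.cast_nonneg n)

theorem five_sixths_le_squareFreeDensity : (5 / 6 : ℝ) ≤ squareFreeDensity := by
  refine le_limsup_of_frequently_le (Eventually.frequently ?_)
    (isBoundedUnder_of ⟨1, maxAvoid_div_le_one⟩)
  filter_upwards [eventually_gt_atTop 0] with n hn
  have h : (5 : ℝ) * n ≤ 6 * maxAvoid geometricSquares (Finset.Icc 1 n) := by
    exact_mod_cast five_mul_le_six_mul_maxAvoid n
  rw [div_le_div_iff₀ (by norm_num) (by exact_mod_cast hn)]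
  linarith

theorem squareFreeDensity_le_one_sub {J : ℕ} (hJ : 0 < J) (D : ℕ) :
    squareFreeDensity ≤ 1 - (∑ j ∈ Finset.range J, (1 / 4 : ℝ) ^ j) *
      ∑ d ∈ Finset.range D, spernerDeficiency d * cubeDensity d := by
  obtain ⟨C, hC⟩ := maxAvoid_Icc_le_sub hJ D
  set L := 1 - (∑ j ∈ Finset.range J, (1 / 4 : ℝ) ^ j) *
      ∑ d ∈ Finset.range D, spernerDeficiency d * cubeDensity d
  have hlim : Tendsto (fun n : ℕ => L + C / (n : ℝ)) atTop (nhds L) := by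
    simpa using tendsto_const_nhds.add (tendsto_const_div_atTop_nhds_zero_nat C)
  rw [← hlim.limsup_eq]
  refine limsup_le_limsup ?_ ?_ hlim.isBoundedUnder_le
  · filter_upwards [eventually_gt_atTop 0] with n hn
    have hn' : (0 : ℝ) < n := by exact_mod_cast hn
    rw [div_le_iff₀ hn', add_mul, div_mul_cancel₀ _ hn'.ne']
    exact hC n
  · exact (isBoundedUnder_of ⟨0, fun n => by positivity⟩ :
      IsBoundedUnder (· ≥ ·) atTop _).isCoboundedUnder_le

/-- The terms are nonnegative, and the upper density bound with J = 1, set against 5/6, bounds the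
partial sums. -/
theorem summable_deficiency_mul_density :
    Summable fun d => spernerDeficiency d * cubeDensity d := by
  refine summable_of_sum_range_le (c := 1)
    (fun d => mul_nonneg (spernerDeficiency_nonneg d) (cubeDensity_pos d).le) fun D => ?_
  have h1 := squareFreeDensity_le_one_sub one_pos D
  have h2 := five_sixths_le_squareFreeDensity
  simp only [Finset.range_one, Finset.sum_singleton, pow_zero, one_mul] at h1
  linarith

theorem squareFreeDensity_le :
    squareFreeDensity ≤ 1 - 4 / 3 * ∑' d, spernerDeficiency d * cubeDensity d := by
  have hg : Tendsto (fun N : ℕ => ∑ j ∈ Finset.range N, (1 / 4 : ℝ) ^ j) atTop (nhds (4 / 3)) := by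
    have := (hasSum_geometric_of_lt_one (r := (1 / 4 : ℝ)) (by norm_num) (by norm_num)).tendsto_sum_nat
    norm_num at this ⊢
    exact this
  have hs := summable_deficiency_mul_density.hasSum.tendsto_sum_nat
  refine ge_of_tendsto ((hg.mul hs).const_sub 1) ?_
  filter_upwards [eventually_gt_atTop 0] with N hN
  exact squareFreeDensity_le_one_sub hN N

theorem one_sub_tsum_lt :
    1 - 4 / 3 * ∑' d, spernerDeficiency d * cubeDensity d < 3699337 / 4002075 := by
  have hnonneg : ∀ d, 0 ≤ spernerDeficiency d * cubeDensity d := fun d =>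
    mul_nonneg (spernerDeficiency_nonneg d) (cubeDensity_pos d).le
  -- The first five terms give the stated constant exactly; a positive term among the next three
  -- makes the inequality strict.
  have hle := summable_deficiency_mul_density.sum_le_tsum (Finset.range 8) fun d _ => hnonneg d
  obtain ⟨k, hk5, hk8, hk⟩ := exists_genSperner_two_succ_lt
  have hkpos : 0 < spernerDeficiency k * cubeDensity k := by
    refine mul_pos ?_ (cubeDensity_pos k)
    have : (genSperner (k + 1) 2 : ℝ) < 2 * genSperner k 2 := by exact_mod_cast hk
    unfold spernerDeficiency
    linarith
  have hlt : ∑ d ∈ Finset.range 5, spernerDeficiency d * cubeDensity d <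
      ∑ d ∈ Finset.range 8, spernerDeficiency d * cubeDensity d :=
    Finset.sum_lt_sum_of_subset (Finset.range_mono (by norm_num)) (Finset.mem_range.2 hk8)
      (by simpa using hk5) hkpos fun d _ _ => hnonneg d
  have hP2 : primorialFirst 2 = 6 := by
    simp [primorialFirst, Fin.prod_univ_succ]
  have hP4 : primorialFirst 4 = 210 := by
    simp [primorialFirst, Fin.prod_univ_succ]
  have hP5 : primorialFirst 5 = 2310 := by
    simp [primorialFirst, Fin.prod_univ_succ]
  have ht2 : Nat.totient 6 = 2 := by decide
  have ht4 : Nat.totient 210 = 48 := by decide +kernel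
  have ht5 : Nat.totient 2310 = 480 := by decide +kernel
  have hsum : ∑ d ∈ Finset.range 5, spernerDeficiency d * cubeDensity d =
      1 / 18 + 4 / 3675 + 8 / 88935 := by
    simp only [Finset.sum_range_succ, Finset.sum_range_zero, spernerDeficiency,
      genSperner_zero_two, genSperner_one_two, genSperner_two_two, genSperner_three_two,
      genSperner_four_two, genSperner_five_two, cubeDensity, zero_add, Nat.reduceAdd, hP2, hP4,
      hP5, ht2, ht4, ht5]
    norm_num
  rw [hsum] at hlt
  linarith

theorem mainTheorem5 :
    (∀ d : ℕ, maxAvoid geometricSquares (primeCube d) = genSperner d 2) ∧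
    (genSperner 0 2 = 1 ∧ genSperner 1 2 = 2 ∧ genSperner 2 2 = 3 ∧
      genSperner 3 2 = 6 ∧ genSperner 4 2 = 11 ∧ genSperner 5 2 = 21) ∧
    (5 / 6 : ℝ) ≤
      limsup (fun n : ℕ => (maxAvoid geometricSquares (Finset.Icc 1 n) : ℝ) / (n : ℝ)) atTop ∧
    Summable (fun d : ℕ => (2 * (genSperner d 2 : ℝ) - (genSperner (d + 1) 2 : ℝ)) *
      ((Nat.totient (primorialFirst (d + 1)) : ℝ) / (primorialFirst (d + 1) : ℝ) ^ 2)) ∧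
    limsup (fun n : ℕ => (maxAvoid geometricSquares (Finset.Icc 1 n) : ℝ) / (n : ℝ)) atTop ≤
      1 - 4 / 3 * ∑' d : ℕ, (2 * (genSperner d 2 : ℝ) - (genSperner (d + 1) 2 : ℝ)) *
        ((Nat.totient (primorialFirst (d + 1)) : ℝ) / (primorialFirst (d + 1) : ℝ) ^ 2) ∧
    1 - 4 / 3 * ∑' d : ℕ, (2 * (genSperner d 2 : ℝ) - (genSperner (d + 1) 2 : ℝ)) *
        ((Nat.totient (primorialFirst (d + 1)) : ℝ) / (primorialFirst (d + 1) : ℝ) ^ 2) <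
      (3699337 / 4002075 : ℝ) := by
  exact ⟨maxAvoid_primeCube, ⟨genSperner_zero_two, genSperner_one_two, genSperner_two_two,
    genSperner_three_two, genSperner_four_two, genSperner_five_two⟩,
    five_sixths_le_squareFreeDensity, summable_deficiency_mul_density, squareFreeDensity_le,
    one_sub_tsum_lt⟩
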